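/- Let $X$ be a real Banach space and let $A\subseteq X\times X$ be a (possibly multivalued) operator on $X$ with $Au=\{v:(u,v)\in A\}$ and effective domain $D(A)=\{u\in X: Au\neq\emptyset\}$. Assume that $A$ is quasi $m$-accretive, that is, for some $\omega\in\mathbb{R}$ the operator $B=A+\omega I$ satisfies $\|u-\hat u\|\le\|u-\hat u+\mu(v-\hat v)\|$ for all $(u,v),(\hat u,\hat v)\in B$ and $\mu\ge 0$, and the range of $I+\mu B$ is $X$ for some $\mu>0$. Let $\alpha\in\mathbb{R}$, $\alpha\neq 1$, and assume that $A$ is homogeneous of order $\alpha$, that is, $0\in A0$, and for all $u\in D(A)$ and $\mu>0$ one has $\mu u\in D(A)$ and $A(\mu u)=\mu^{\alpha}Au$. For $T>0$, $u_0\in\overline{D(A)}$ and $f\in L^1(0,T;X)$, a mild solution of $\frac{du}{dt}+A(u(t))\ni f(t)$ on $(0,T)$, $u(0)=u_0$, is a function $u\in C([0,T];X)$ with $u(0)=u_0$ such that for every $\varepsilon>0$ there are a partition $0=t_0<t_1<\dots<t_N=T$ and $u_1,\dots,u_N\in X$ with $t_i-t_{i-1}<\varepsilon$ and $\frac{u_i-u_{i-1}}{t_i-t_{i-1}}+Au_i\ni\bar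 f_i:=\frac{1}{t_i-t_{i-1}}\int_{t_{i-1}}^{t_i}f(t)\,dt$ for $i=1,\dots,N$, with $\sum_{i=1}^{N}\int_{t_{i-1}}^{t_i}\|f(t)-\bar f_i\|\,dt<\varepsilon$, and with $\|u(t)-u_i\|<\varepsilon$ for all $t\in(t_{i-1},t_i]$ and $i=1,\dots,N$. Then for all such $T$, $u_0$ and $f$ there is exactly one mild solution $u$; write $T_t(u_0,f):=u(t)$ for $t\in[0,T]$ (the semigroup generated by $-A$; on each time interval $[0,T]$ it acts on $\overline{D(A)}\times L^1(0,T;X)$). Moreover, for every $\lambda>0$, $T>0$, $u_0\in\overline{D(A)}$ and $f\in L^1(0,T;X)$, $$\lambda^{\frac{1}{\alpha-1}}\,T_{\lambda t}(u_0,f)=T_t\bigl(\lambda^{\frac{1}{\alpha-1}}u_0,\ \lambda^{\frac{\alpha}{\alpha-1}}f(\lambda\,\cdot)\bigr)\qquad\text{for all } t\in\bigl[0,\tfrac{T}{\lambda}\bigr],$$ where the right-hand side is taken on the time interval $[0,T/\lambda]$, with $f(\lambda\,\cdot)\in L^1(0,T/\lambda;X)$. -/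

import Mathlib

open Set MeasureTheory
open scoped Pointwise

namespace NonlinearEvolution

section

variable {X : Type*} [NormedAddCommGroup X] [NormedSpace ℝ X]

/-- The value `A u` of a (possibly multivalued) operator, given by its graph `A ⊆ X × X`. -/
def value (A : Set (X × X)) (u : X) : Set X := {v | (u, v) ∈ A}

/-- The effective domain `D(A) = {u | A u ≠ ∅}`. -/
def domain (A : Set (X × X)) : Set X := {u | (value A u).Nonempty}

/-- The operator `A + ω I`. -/
def shift (A : Set (X × X)) (ω : ℝ) : Set (X × X) :=
  {p | ∃ v, (p.1, v) ∈ A ∧ p.2 = v + ω • p.1}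

/-- `A` is accretive in `X`. -/
def IsAccretive (A : Set (X × X)) : Prop :=
  ∀ u v u' v' : X, (u, v) ∈ A → (u', v') ∈ A →
    ∀ r : ℝ, 0 ≤ r → ‖u - u'‖ ≤ ‖u - u' + r • (v - v')‖

/-- `A` is `m`-accretive in `X`: accretive, with `Rg (I + r A) = X` for some `r > 0`. -/
def IsMAccretive (A : Set (X × X)) : Prop :=
  IsAccretive A ∧ ∃ r : ℝ, 0 < r ∧ ∀ x : X, ∃ u v : X, (u, v) ∈ A ∧ u + r • v = x

/-- `A` is quasi `m`-accretive in `X`: `A + ω I` is `m`-accretive for some real `ω`. -/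
def IsQuasiMAccretive (A : Set (X × X)) : Prop :=
  ∃ ω : ℝ, IsMAccretive (shift A ω)

/-- `A` is homogeneous of order `α`: `0 ∈ A 0` and `A (r u) = r ^ α A u` for `u ∈ D(A)` and
`r > 0`. The value `r = 0` is left out, as `0 ^ α` has no meaning for `α < 0`; where it is
asked for in addition, the class of homogeneous operators is smaller. -/
def IsHomogeneous (A : Set (X × X)) (α : ℝ) : Prop :=
  (0 : X) ∈ value A 0 ∧
    ∀ u ∈ domain A, ∀ r : ℝ, 0 < r →
      r • u ∈ domain A ∧ value A (r • u) = (r ^ α) • value A u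

/-- The mean value of `f` on the interval `(a, b]`. -/
noncomputable def mean (f : ℝ → X) (a b : ℝ) : X := (b - a)⁻¹ • ∫ t in a..b, f t

/-- `u` is a mild solution of `u' + A u ∋ f` on `(0, T)` with `u(0) = u₀`: it is continuous on
`[0, T]`, and for every `ε > 0` there are a partition `0 = τ 0 < τ 1 < ⋯ < τ N = T` and values
`x 0 = u₀, x 1, …, x N` that solve the implicit Euler scheme, such that the mesh is less than `ε`,
the `L¹`-distance of `f` from its means on the partition intervals is less than `ε`, and `u` is
within `ε` of the step function which is `u₀` at `0` and `x (i + 1)` on `(τ i, τ (i + 1)]`. -/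
structure IsMildSolution (A : Set (X × X)) (T : ℝ) (u₀ : X) (f : ℝ → X) (u : ℝ → X) : Prop where
  continuousOn : ContinuousOn u (Icc 0 T)
  initial : u 0 = u₀
  approx : ∀ ε : ℝ, 0 < ε → ∃ (N : ℕ) (τ : ℕ → ℝ) (x : ℕ → X),
    τ 0 = 0 ∧ τ N = T ∧ x 0 = u₀ ∧
    (∀ i < N, τ i < τ (i + 1)) ∧
    (∀ i < N, τ (i + 1) - τ i < ε) ∧
    ∑ i ∈ Finset.range N, ∫ t in (τ i)..(τ (i + 1)), ‖f t - mean f (τ i) (τ (i + 1))‖ < ε ∧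
    (∀ i < N, ∃ v ∈ value A (x (i + 1)),
      (τ (i + 1) - τ i)⁻¹ • (x (i + 1) - x i) + v = mean f (τ i) (τ (i + 1))) ∧
    (∀ i < N, ∀ t ∈ Ioc (τ i) (τ (i + 1)), ‖u t - x (i + 1)‖ < ε)

/-- The semigroup generated by `-A` on the time interval `[0, T]`: `semigroup A T t u₀ f` is
`T_t (u₀, f) = u(t)`, where `u` is the mild solution of `u' + A u ∋ f` on `(0, T)`, `u(0) = u₀`
(and `0` in the absence of a mild solution). -/
noncomputable def semigroup (A : Set (X × X)) (T t : ℝ) (u₀ : X) (f : ℝ → X) : X :=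
  open Classical in
  if h : ∃ u : ℝ → X, IsMildSolution A T u₀ f u then h.choose t else 0

end

end NonlinearEvolution

/-! The scaling identity rests on uniqueness. If `r * ρ = ρ ^ α`, then dividing the times of an
Euler scheme by `r` and multiplying its values by `ρ` multiplies both the difference quotients and,
by homogeneity, the values of `A` by `ρ ^ α`. The result is an Euler scheme for the data `ρ • u₀`
and `ρ ^ α • f (r * ·)`, so mild solutions rescale to mild solutions (`IsMildSolution.rescale`). For
`α ≠ 1` the relation is solved by `ρ = r ^ (1 / (α - 1))`.

Existence and uniqueness both follow from `exists_forall_norm_sub_le`: any two sufficiently fine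
Euler schemes with the same data are close at neighbouring times. Schemes exist because the range
condition passes to all step sizes, and completeness gives their limit. For the estimate,
accretivity bounds the distances `‖x i - y j‖` by a recurrence in the two indices
(`euler_step_comparison`), which is dominated by an explicit supersolution (`le_majorant`). Its
quadratic term measures the time difference `s i - t j`. The boundary values come from comparison
with a point of the graph near `u₀`, and the forcing is controlled by one continuous function that
is close to `f` in `L¹`. -/

namespace NonlinearEvolution

section

variable {X : Type*} [NormedAddCommGroup X] [NormedSpace ℝ X]

/-! ### Accretive operators: the implicit Euler step -/

/-- Comparison of two implicit Euler steps with step sizes `γ` and `δ`. -/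
lemma euler_step_comparison {A : Set (X × X)} {ω : ℝ} (hA : IsAccretive (shift A ω))
    {x x' y y' v w f g : X} {γ δ : ℝ} (hγ : 0 < γ) (hδ : 0 < δ)
    (hv : v ∈ value A x) (hw : w ∈ value A y)
    (hx : γ⁻¹ • (x - x') + v = f) (hy : δ⁻¹ • (y - y') + w = g) :
    (γ + δ - |ω| * γ * δ) * ‖x - y‖ ≤ δ * ‖x' - y‖ + γ * ‖x - y'‖ + γ * δ * ‖f - g‖ := by
  have hγδ : 0 < γ * δ := mul_pos hγ hδ
  have hle : (γ + δ - |ω| * γ * δ) * ‖x - y‖ ≤ (γ + δ - ω * γ * δ) * ‖x - y‖ := by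
    have : ω * (γ * δ) ≤ |ω| * (γ * δ) := mul_le_mul_of_nonneg_right (le_abs_self ω) hγδ.le
    exact mul_le_mul_of_nonneg_right (by linarith) (norm_nonneg _)
  refine hle.trans ?_
  -- Accretivity will be used with parameter `γ * δ / κ`, which needs `κ > 0`; otherwise the left
  -- side is nonpositive. Multiplication by `κ` then cancels `ω`, and the two Euler equations
  -- eliminate `v` and `w`.
  by_cases hpos : γ + δ - ω * γ * δ ≤ 0
  · exact (mul_nonpos_of_nonpos_of_nonneg hpos (norm_nonneg _)).trans (by positivity)
  push Not at hpos
  set κ := γ + δ - ω * γ * δ with hκ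
  have h := hA x (v + ω • x) y (w + ω • y) ⟨v, hv, rfl⟩ ⟨w, hw, rfl⟩ (γ * δ / κ) (by positivity)
  have key : κ • (x - y + (γ * δ / κ) • (v + ω • x - (w + ω • y))) =
      δ • (x' - y) + γ • (x - y') + (γ * δ) • (f - g) := by
    rw [← hx, ← hy, smul_add, smul_smul, mul_div_cancel₀ _ hpos.ne', hκ]
    match_scalars <;> field_simp <;> ring
  calc κ * ‖x - y‖ ≤ κ * ‖x - y + (γ * δ / κ) • (v + ω • x - (w + ω • y))‖ :=
        mul_le_mul_of_nonneg_left h hpos.le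
    _ = ‖δ • (x' - y) + γ • (x - y') + (γ * δ) • (f - g)‖ := by
        rw [← key, norm_smul, Real.norm_of_nonneg hpos.le]
    _ ≤ ‖δ • (x' - y)‖ + ‖γ • (x - y')‖ + ‖(γ * δ) • (f - g)‖ := norm_add₃_le
    _ = _ := by
        rw [norm_smul, norm_smul, norm_smul, Real.norm_of_nonneg hγ.le, Real.norm_of_nonneg hδ.le,
          Real.norm_of_nonneg hγδ.le]

/-- Comparison of an implicit Euler step with a point of the graph. -/
lemma euler_step_comparison_graph {A : Set (X × X)} {ω : ℝ} (hA : IsAccretive (shift A ω))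
    {x x' z v w f : X} {γ : ℝ} (hγ : 0 < γ) (hv : v ∈ value A x) (hw : w ∈ value A z)
    (hx : γ⁻¹ • (x - x') + v = f) :
    (1 - |ω| * γ) * ‖x - z‖ ≤ ‖x' - z‖ + γ * ‖f - w‖ := by
  -- A point `(z, w)` of the graph is a stationary Euler step from `z` to `z` with forcing `w`.
  have h := euler_step_comparison hA hγ hγ hv hw hx (y' := z) (g := w) (by simp)
  have h' : γ * ((1 - |ω| * γ) * ‖x - z‖) ≤ γ * (‖x' - z‖ + γ * ‖f - w‖) := by linarith
  exact le_of_mul_le_mul_left h' hγ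

/-- If `I + r₀ B` is onto, then so is `I + r B` for every `r > r₀ / 2`. -/
lemma IsAccretive.surjective_of_half_lt [CompleteSpace X] {B : Set (X × X)} (hB : IsAccretive B)
    {r₀ r : ℝ} (hr₀ : 0 < r₀) (hr : r₀ / 2 < r)
    (h : ∀ x : X, ∃ u v : X, (u, v) ∈ B ∧ u + r₀ • v = x) (x : X) :
    ∃ u v : X, (u, v) ∈ B ∧ u + r • v = x := by
  choose J V hJ hJV using h
  have hr' : 0 < r := by linarith
  set q : ℝ := r₀ / r with hq
  have hq0 : 0 < q := by positivity
  have hq2 : q < 2 := by rw [hq, div_lt_iff₀ hr']; linarith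
  have hne : ∀ a b, ‖J a - J b‖ ≤ ‖a - b‖ := fun a b => by
    have := hB _ _ _ _ (hJ a) (hJ b) r₀ hr₀.le
    have e : J a - J b + r₀ • (V a - V b) = a - b := by
      rw [← hJV a, ← hJV b, hJV, hJV, smul_sub]
      nth_rw 3 [← hJV a]
      nth_rw 3 [← hJV b]
      abel
    rwa [e] at this
  -- With `J` the resolvent at `r₀`, the equation `u + r • v = x` says that `u` is a fixed point of
  -- `G`. As `J` is nonexpansive, `G` contracts by `|1 - q|`, which is below 1 exactly for `0 < q <
  -- 2`.
  let G : X → X := fun u => J (q • x + (1 - q) • u)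
  have hG : ContractingWith ‖1 - q‖₊ G := by
    refine ⟨?_, LipschitzWith.of_dist_le_mul fun a b => ?_⟩
    · rw [← NNReal.coe_lt_coe, coe_nnnorm, Real.norm_eq_abs, NNReal.coe_one, abs_lt]
      constructor <;> linarith
    · rw [dist_eq_norm, dist_eq_norm, coe_nnnorm, ← norm_smul]
      refine (hne _ _).trans_eq ?_
      congr 1
      module
  have hfix : G (hG.fixedPoint G) = hG.fixedPoint G := hG.fixedPoint_isFixedPt
  set u := hG.fixedPoint G
  have hu := hJV (q • x + (1 - q) • u)
  have huB := hJ (q • x + (1 - q) • u)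
  change J (q • x + (1 - q) • u) = u at hfix
  rw [hfix] at hu huB
  refine ⟨u, _, huB, ?_⟩
  set v := V (q • x + (1 - q) • u)
  have h1 : r₀ • v = q • (x - u) := by
    rw [← sub_eq_zero] at hu ⊢
    rw [← hu]; module
  have h2 : r • v = x - u := by
    have : r • v = q⁻¹ • (r₀ • v) := by
      rw [smul_smul, hq]; congr 1; field_simp
    rw [this, h1, smul_smul, inv_mul_cancel₀ hq0.ne', one_smul]
  rw [h2]; abel

/-- Each use of the contraction argument halves the lower bound on the admissible parameters, so
finitely many uses reach any `r > 0`. -/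
lemma IsMAccretive.surjective [CompleteSpace X] {B : Set (X × X)} (hB : IsMAccretive B)
    {r : ℝ} (hr : 0 < r) (x : X) : ∃ u v : X, (u, v) ∈ B ∧ u + r • v = x := by
  obtain ⟨hacc, r₀, hr₀, h₀⟩ := hB
  have key : ∀ n : ℕ, ∀ s : ℝ, r₀ / 2 ^ n < s → ∀ x : X, ∃ u v : X, (u, v) ∈ B ∧ u + s • v = x := by
    intro n
    induction n with
    | zero => exact fun s hs => hacc.surjective_of_half_lt hr₀ (by simp at hs; linarith) h₀
    | succ n ih =>
      intro s hs
      have h1 : r₀ / 2 ^ n < 2 * s := by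
        rw [div_lt_iff₀ (by positivity)] at hs ⊢
        rw [pow_succ] at hs; linarith
      have hs0 : 0 < s := lt_trans (by positivity) hs
      obtain ⟨m, hm1, hm2⟩ := exists_between h1
      exact hacc.surjective_of_half_lt (lt_trans (by positivity) hm1) (by linarith) (ih m hm1)
  obtain ⟨n, hn⟩ := exists_nat_gt (r₀ / r)
  refine key n r ?_ x
  have h2 : (n : ℝ) < 2 ^ n := by exact_mod_cast Nat.lt_two_pow_self
  rw [div_lt_iff₀ hr] at hn
  rw [div_lt_iff₀ (by positivity)]
  nlinarith

/-- The implicit Euler step is solvable for small step sizes. -/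
lemma exists_euler_step [CompleteSpace X] {A : Set (X × X)} {ω : ℝ} (hA : IsMAccretive (shift A ω))
    {h : ℝ} (hh : 0 < h) (hω : |ω| * h < 1) (y m : X) :
    ∃ x, ∃ v ∈ value A x, h⁻¹ • (x - y) + v = m := by
  have hpos : 0 < 1 - ω * h := by
    have := mul_le_mul_of_nonneg_right (le_abs_self ω) hh.le
    linarith
  set κ := 1 - ω * h with hκ
  -- Since `w = v + ω • u`, one has `κ • u + h • w = u + h • v`; this fixes the parameter and the
  -- right side.
  obtain ⟨u, w, ⟨v, hv, hw⟩, huw⟩ := hA.surjective (r := h / κ) (by positivity) (κ⁻¹ • (y + h • m))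
  refine ⟨u, v, hv, ?_⟩
  have e : κ • u + h • w = y + h • m := by
    rw [← smul_inv_smul₀ hpos.ne' (y + h • m), ← huw, smul_add, smul_smul,
      mul_div_cancel₀ _ hpos.ne']
  simp only at hw
  rw [hw, ← sub_eq_zero] at e
  rw [← sub_eq_zero]
  have : h⁻¹ • (u - y) + v - m = h⁻¹ • (κ • u + h • (v + ω • u) - (y + h • m)) := by
    rw [hκ]
    match_scalars <;> field_simp
    ring
  rw [this, e, smul_zero]

end

/-! ### The double recurrence -/

/-- The quadratic part of the supersolution of the double recurrence. -/
noncomputable def quad (ε s t : ℝ) : ℝ := (s - t) ^ 2 + ε * (s + t) + 3 * ε ^ 2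

/-- Averaging the square creates an excess `γ * δ * (γ + δ)`, which the gain `2 * ε * γ * δ` from
the linear term absorbs. The constant `3 * ε ^ 2` makes `quad` at most double over one step, so the
decay `2 * W` on the left pays for the loss `W` on the right. -/
lemma quad_step {ε s t γ δ W : ℝ} (hγ : 0 ≤ γ) (hδ : 0 ≤ δ) (hγε : γ ≤ ε) (hδε : δ ≤ ε)
    (hs : 0 ≤ s) (ht : 0 ≤ t) (hW : 0 ≤ W) :
    δ * (1 - (2 * W + 1) * γ) * quad ε s (t + δ) + γ * quad ε (s + γ) t
      + γ * δ * quad ε s (t + δ) ≤ (γ + δ - W * γ * δ) * quad ε (s + γ) (t + δ) := by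
  have h1 : δ * quad ε s (t + δ) + γ * quad ε (s + γ) t ≤ (γ + δ) * quad ε (s + γ) (t + δ) := by
    have : 0 ≤ γ * δ * ((ε - γ) + (ε - δ)) :=
      mul_nonneg (mul_nonneg hγ hδ) (by linarith)
    unfold quad
    nlinarith
  have h2 : quad ε (s + γ) (t + δ) ≤ 2 * quad ε s (t + δ) := by
    have hε : 0 ≤ ε := hγ.trans hγε
    have a1 : γ ^ 2 ≤ ε ^ 2 := pow_le_pow_left₀ hγ hγε 2
    have a2 : ε * γ ≤ ε ^ 2 := by nlinarith
    have a3 : 0 ≤ ε * (s + (t + δ)) := by positivity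
    unfold quad
    nlinarith [sq_nonneg (s - (t + δ) - γ)]
  have h3 := mul_le_mul_of_nonneg_left h2 (mul_nonneg hW (mul_nonneg hγ hδ))
  linarith

/-- Turns the exponential weight of the majorants into a linear factor gained at each step. -/
lemma exp_neg_two_mul_le {x : ℝ} (h0 : 0 ≤ x) (h1 : 2 * x ≤ 1) : Real.exp (-(2 * x)) ≤ 1 - x := by
  have h := Real.add_one_le_exp (2 * x)
  rw [Real.exp_neg]
  have hpos : 0 < 2 * x + 1 := by linarith
  refine (inv_anti₀ hpos h).trans ?_
  rw [inv_le_iff_one_le_mul₀ hpos]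
  nlinarith

/-- The weighted sum `∑ l < i, (s (l + 1) - s l) e l`. -/
noncomputable def stepSum (s e : ℕ → ℝ) (i : ℕ) : ℝ :=
  ∑ l ∈ Finset.range i, (s (l + 1) - s l) * e l

lemma stepSum_succ (s e : ℕ → ℝ) (i : ℕ) :
    stepSum s e (i + 1) = stepSum s e i + (s (i + 1) - s i) * e i := by
  simp [stepSum, Finset.sum_range_succ]

lemma stepSum_nonneg {s e : ℕ → ℝ} {N i : ℕ} (hs : ∀ i < N, s i < s (i + 1)) (he : ∀ i, 0 ≤ e i)
    (hi : i ≤ N) : 0 ≤ stepSum s e i :=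
  Finset.sum_nonneg fun l hl =>
    mul_nonneg (sub_nonneg.2 (hs l ((Finset.mem_range.1 hl).trans_le hi)).le) (he l)

lemma partition_nonneg {s : ℕ → ℝ} {N : ℕ} (h0 : s 0 = 0) (hs : ∀ i < N, s i < s (i + 1)) :
    ∀ i ≤ N, 0 ≤ s i := by
  intro i
  induction i with
  | zero => intro _; exact h0.ge
  | succ i ih => intro hi; exact (ih (by omega)).trans (hs i (by omega)).le

lemma partition_le {s : ℕ → ℝ} {N : ℕ} (hs : ∀ i < N, s i < s (i + 1)) {i : ℕ} (hi : i ≤ N) :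
    s i ≤ s N := by
  induction N, hi using Nat.le_induction with
  | base => exact le_rfl
  | succ n hn ih => exact (ih fun i hi => hs i (by omega)).trans (hs n (by omega)).le

/-- The supersolution of the double recurrence. -/
noncomputable def majorant (W ε c C : ℝ) (s t e e' : ℕ → ℝ) (i j : ℕ) : ℝ :=
  Real.exp (2 * (2 * W + 1) * (s i + t j)) *
    (c + 2 * stepSum s e i + 2 * stepSum t e' j + C * quad ε (s i) (t j))

/-- Discrete comparison principle: a subsolution below the majorant on both axes stays below it on
the whole grid, by induction on `i` and then `j`. The rate `2 * (2 * W + 1)` leaves room for the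
`W`-term and for the source parts `c` and `C * quad`. The factor 2 on the step sums pays for `e` and
`e'`. -/
lemma le_majorant {W ε c C : ℝ} (hW : 0 ≤ W) (hε : 2 * (2 * W + 1) * ε ≤ 1) (hc : 0 ≤ c)
    (hC : 0 ≤ C) {N M : ℕ} {s t e e' : ℕ → ℝ} {a F : ℕ → ℕ → ℝ}
    (hs0 : s 0 = 0) (ht0 : t 0 = 0)
    (hs : ∀ i < N, s i < s (i + 1)) (ht : ∀ j < M, t j < t (j + 1))
    (hsε : ∀ i < N, s (i + 1) - s i ≤ ε) (htε : ∀ j < M, t (j + 1) - t j ≤ ε)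
    (he : ∀ i, 0 ≤ e i) (he' : ∀ j, 0 ≤ e' j)
    (hstep : ∀ i < N, ∀ j < M,
      ((s (i + 1) - s i) + (t (j + 1) - t j) - W * (s (i + 1) - s i) * (t (j + 1) - t j))
        * a (i + 1) (j + 1) ≤ (t (j + 1) - t j) * a i (j + 1) + (s (i + 1) - s i) * a (i + 1) j
          + (s (i + 1) - s i) * (t (j + 1) - t j) * F i j)
    (hF : ∀ i < N, ∀ j < M, F i j ≤ e i + e' j + c + C * quad ε (s i) (t (j + 1)))
    (hi0 : ∀ i ≤ N, a i 0 ≤ majorant W ε c C s t e e' i 0)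
    (h0j : ∀ j ≤ M, a 0 j ≤ majorant W ε c C s t e e' 0 j) :
    ∀ i ≤ N, ∀ j ≤ M, a i j ≤ majorant W ε c C s t e e' i j := by
  intro i
  induction i with
  | zero => exact fun _ => h0j
  | succ i ihi =>
    intro hi j
    induction j with
    | zero => intro _; exact hi0 _ hi
    | succ j ihj =>
      intro hj
      have b1 := ihi (by omega) (j + 1) hj
      have b2 := ihj (by omega)
      have hst := hstep i (by omega) j (by omega)
      have hFij := hF i (by omega) j (by omega)
      have hγ := sub_pos.2 (hs i (by omega))
      have hδ := sub_pos.2 (ht j (by omega))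
      have hγε := hsε i (by omega)
      have hδε := htε j (by omega)
      have hsi := partition_nonneg hs0 hs i (by omega)
      have htj := partition_nonneg ht0 ht j (by omega)
      have hE := stepSum_nonneg hs he (show i ≤ N by omega)
      have hE' := stepSum_nonneg ht he' hj
      have hE'0 := stepSum_nonneg ht he' (show j ≤ M by omega)
      have eE := stepSum_succ s e i
      have eE' := stepSum_succ t e' j
      have hei := he i
      have hej := he' j
      unfold majorant at b1 b2 ⊢
      generalize hγd : s (i + 1) - s i = γ at *
      generalize hδd : t (j + 1) - t j = δ at *
      have es : s (i + 1) = s i + γ := by linarith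
      have et : t (j + 1) = t j + δ := by linarith
      rw [es] at b2 ⊢
      rw [et] at b1 hFij ⊢
      generalize s i = σ at *
      generalize t j = τ at *
      generalize stepSum s e i = E at *
      generalize stepSum s e (i + 1) = E₁ at *
      generalize stepSum t e' j = G at *
      generalize stepSum t e' (j + 1) = G₁ at *
      generalize e i = η at *
      generalize e' j = η' at *
      have hq := quad_step (W := W) hγ.le hδ.le hγε hδε hsi htj hW
      have hε0 : 0 ≤ ε := hγ.le.trans hγε
      have hqpos : ∀ x y : ℝ, 0 ≤ x → 0 ≤ y → 0 ≤ quad ε x y := fun x y hx hy => by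
        unfold quad; positivity
      have hq1 := hqpos σ (τ + δ) hsi (by linarith)
      have hq2 := hqpos (σ + γ) τ (by linarith) htj
      generalize quad ε σ (τ + δ) = q₁ at *
      generalize quad ε (σ + γ) τ = q₂ at *
      generalize quad ε (σ + γ) (τ + δ) = q at *
      set k := 2 * W + 1 with hk
      set P := Real.exp (2 * k * (σ + γ + (τ + δ))) with hP
      have hP1 : 1 ≤ P := Real.one_le_exp (by positivity)
      have hkγ : k * γ ≤ k * ε := mul_le_mul_of_nonneg_left hγε (by positivity)
      have hWγ : W * γ ≤ 1 / 4 := by nlinarith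
      -- The weight one step back in `i` is smaller by a factor `1 - k * γ`; the weight one step
      -- back in `j` is only bounded by `P`.
      have p1 : Real.exp (2 * k * (σ + (τ + δ))) ≤ P * (1 - k * γ) := by
        have : 2 * k * (σ + (τ + δ)) = 2 * k * (σ + γ + (τ + δ)) + -(2 * (k * γ)) := by ring
        rw [this, Real.exp_add]
        exact mul_le_mul_of_nonneg_left
          (exp_neg_two_mul_le (by positivity) (by linarith)) (by positivity)
      have p2 : Real.exp (2 * k * (σ + γ + τ)) ≤ P :=
        Real.exp_le_exp.2 (mul_le_mul_of_nonneg_left (by linarith) (by positivity))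
      have hκ : 0 < γ + δ - W * γ * δ := by nlinarith
      have c1 : a i (j + 1) ≤ P * (1 - k * γ) * (c + 2 * E + 2 * G₁ + C * q₁) :=
        b1.trans (mul_le_mul_of_nonneg_right p1 (by positivity))
      have hE1 : 0 ≤ E₁ := by rw [eE]; positivity
      have c2 : a (i + 1) j ≤ P * (c + 2 * E₁ + 2 * G + C * q₂) :=
        b2.trans (mul_le_mul_of_nonneg_right p2 (by positivity))
      have c3 : F i j ≤ P * (η + η' + c + C * q₁) :=
        hFij.trans (le_mul_of_one_le_left (by positivity) hP1)
      refine le_of_mul_le_mul_left (hst.trans ?_) hκ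
      have main : δ * ((1 - k * γ) * (c + 2 * E + 2 * G₁ + C * q₁))
          + γ * (c + 2 * E₁ + 2 * G + C * q₂) + γ * δ * (η + η' + c + C * q₁) ≤
          (γ + δ - W * γ * δ) * (c + 2 * E₁ + 2 * G₁ + C * q) := by
        have hγδ : 0 ≤ γ * δ := by positivity
        have m1 : 0 ≤ γ * δ * (W * c) := by positivity
        have m2 : 0 ≤ γ * δ * ((W + 1) * E) := by positivity
        have m2' : 0 ≤ γ * δ * (η * (1 / 4 - W * γ)) :=
          mul_nonneg hγδ (mul_nonneg hei (by linarith))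
        have m2'' : 0 ≤ γ * δ * η := by positivity
        have m3 : 0 ≤ γ * δ * ((W + 1) * G₁) := by positivity
        have m4 := mul_le_mul_of_nonneg_left hq hC
        have g1 : δ * ((1 - k * γ) * c) + γ * c + γ * δ * c ≤ (γ + δ - W * γ * δ) * c := by
          rw [hk]; linarith
        have g2 : δ * ((1 - k * γ) * (2 * E)) + γ * (2 * E₁) + γ * δ * η ≤
            (γ + δ - W * γ * δ) * (2 * E₁) := by
          rw [hk, eE]; linarith
        have g3 : δ * ((1 - k * γ) * (2 * G₁)) + γ * (2 * G) + γ * δ * η' ≤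
            (γ + δ - W * γ * δ) * (2 * G₁) := by
          have : G = G₁ - δ * η' := by linarith
          have : 0 ≤ γ * δ * η' := by positivity
          rw [hk, ‹G = _›]; linarith
        linarith
      calc _ ≤ δ * (P * (1 - k * γ) * (c + 2 * E + 2 * G₁ + C * q₁))
            + γ * (P * (c + 2 * E₁ + 2 * G + C * q₂)) + γ * δ * (P * (η + η' + c + C * q₁)) := by
            gcongr
        _ = P * (δ * ((1 - k * γ) * (c + 2 * E + 2 * G₁ + C * q₁))
          + γ * (c + 2 * E₁ + 2 * G + C * q₂) + γ * δ * (η + η' + c + C * q₁)) := by ring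
        _ ≤ P * ((γ + δ - W * γ * δ) * (c + 2 * E₁ + 2 * G₁ + C * q)) := by gcongr
        _ = _ := by ring

/-- The single recurrence that governs the distance to a point of the graph. -/
lemma le_exp_mul_of_recurrence {W ε K : ℝ} (hW : 0 ≤ W) (hε : 2 * (2 * W + 1) * ε ≤ 1) (hK : 0 ≤ K)
    {N : ℕ} {s e b : ℕ → ℝ} (hs0 : s 0 = 0) (hs : ∀ i < N, s i < s (i + 1))
    (hsε : ∀ i < N, s (i + 1) - s i ≤ ε) (he : ∀ i, 0 ≤ e i) (hb0 : 0 ≤ b 0)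
    (hstep : ∀ i < N, (1 - W * (s (i + 1) - s i)) * b (i + 1) ≤
      b i + (s (i + 1) - s i) * (e i + K)) :
    ∀ i ≤ N, b i ≤ Real.exp (2 * (2 * W + 1) * s i) * (b 0 + 2 * stepSum s e i + 2 * K * s i) := by
  intro i
  induction i with
  | zero => intro _; simp [hs0, stepSum]
  | succ i ih =>
    intro hi
    have b1 := ih (by omega)
    have hst := hstep i (by omega)
    have hγ := sub_pos.2 (hs i (by omega))
    have hγε := hsε i (by omega)
    have hsi := partition_nonneg hs0 hs i (by omega)
    have hE := stepSum_nonneg hs he (show i ≤ N by omega)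
    have eE := stepSum_succ s e i
    have hei := he i
    generalize hγd : s (i + 1) - s i = γ at *
    have es : s (i + 1) = s i + γ := by linarith
    rw [es, eE]
    generalize s i = σ at *
    generalize stepSum s e i = E at *
    generalize e i = η at *
    set k := 2 * W + 1 with hk
    set P := Real.exp (2 * k * (σ + γ)) with hP
    have hP1 : 1 ≤ P := Real.one_le_exp (by positivity)
    have hkγ : k * γ ≤ k * ε := mul_le_mul_of_nonneg_left hγε (by positivity)
    have hWγ : W * γ ≤ 1 / 4 := by nlinarith
    have p1 : Real.exp (2 * k * σ) ≤ P * (1 - k * γ) := by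
      have : 2 * k * σ = 2 * k * (σ + γ) + -(2 * (k * γ)) := by ring
      rw [this, Real.exp_add]
      exact mul_le_mul_of_nonneg_left
        (exp_neg_two_mul_le (by positivity) (by linarith)) (by positivity)
    have hκ : 0 < 1 - W * γ := by linarith
    refine le_of_mul_le_mul_left (hst.trans ?_) hκ
    set B := b 0 + 2 * E + 2 * K * σ with hB
    have hBpos : 0 ≤ B := by positivity
    have main : (1 - k * γ) * B + γ * (η + K) ≤ (1 - W * γ) * (B + 2 * (γ * (η + K))) := by
      have n1 : 0 ≤ (W + 1) * γ * B := by positivity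
      have n2 : 0 ≤ (1 / 4 - W * γ) * (γ * (η + K)) :=
        mul_nonneg (by linarith) (by positivity)
      have n3 : 0 ≤ γ * (η + K) := by positivity
      rw [hk]; nlinarith
    calc b i + γ * (η + K) ≤ P * (1 - k * γ) * B + P * (γ * (η + K)) :=
          add_le_add (b1.trans (mul_le_mul_of_nonneg_right p1 hBpos))
            (le_mul_of_one_le_left (by positivity) hP1)
      _ = P * ((1 - k * γ) * B + γ * (η + K)) := by ring
      _ ≤ P * ((1 - W * γ) * (B + 2 * (γ * (η + K)))) := by gcongr
      _ = _ := by rw [hB]; ring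

section

variable {X : Type*} [NormedAddCommGroup X] [NormedSpace ℝ X]

/-! ### Means over partitions -/

lemma intervalIntegrable_of_partition {E : Type*} [NormedAddCommGroup E] {T : ℝ} {f : ℝ → E}
    (hf : IntegrableOn f (Ioo 0 T) volume)
    {N : ℕ} {τ : ℕ → ℝ} (h0 : τ 0 = 0) (hN : τ N = T) (hlt : ∀ i < N, τ i < τ (i + 1))
    {i : ℕ} (hi : i < N) : IntervalIntegrable f volume (τ i) (τ (i + 1)) := by
  rw [intervalIntegrable_iff_integrableOn_Ioo_of_le (hlt i hi).le]
  refine hf.mono_set (Ioo_subset_Ioo (partition_nonneg h0 hlt i hi.le) ?_)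
  rw [← hN]; exact partition_le hlt hi

lemma mul_norm_mean_sub_le [CompleteSpace X] {f : ℝ → X} {a b : ℝ} (hab : a < b)
    (hf : IntervalIntegrable f volume a b) (c : X) :
    (b - a) * ‖mean f a b - c‖ ≤ ∫ t in a..b, ‖f t - c‖ := by
  have hpos : 0 < b - a := sub_pos.2 hab
  have e : (b - a) • (mean f a b - c) = ∫ t in a..b, (f t - c) := by
    rw [intervalIntegral.integral_sub hf intervalIntegrable_const,
      intervalIntegral.integral_const, mean, smul_sub, smul_inv_smul₀ hpos.ne']
  rw [← Real.norm_of_nonneg hpos.le, ← norm_smul, e]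
  exact intervalIntegral.norm_integral_le_integral_norm hab.le

/-- Up to a factor 2, the mean approximates `f` in `L¹` as well as any constant does. -/
lemma integral_norm_sub_mean_le [CompleteSpace X] {f : ℝ → X} {a b : ℝ} (hab : a < b)
    (hf : IntervalIntegrable f volume a b) (c : X) :
    ∫ t in a..b, ‖f t - mean f a b‖ ≤ 2 * ∫ t in a..b, ‖f t - c‖ := by
  have h := mul_norm_mean_sub_le hab hf c
  have i1 : IntervalIntegrable (fun t => ‖f t - c‖) volume a b :=
    (hf.sub intervalIntegrable_const).norm
  calc ∫ t in a..b, ‖f t - mean f a b‖ ≤ ∫ t in a..b, (‖f t - c‖ + ‖mean f a b - c‖) := by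
        refine intervalIntegral.integral_mono_on hab.le
          (hf.sub intervalIntegrable_const).norm (i1.add intervalIntegrable_const) fun t _ => ?_
        rw [norm_sub_rev (mean f a b) c]
        exact norm_sub_le_norm_sub_add_norm_sub _ _ _
    _ = (∫ t in a..b, ‖f t - c‖) + (b - a) * ‖mean f a b - c‖ := by
        rw [intervalIntegral.integral_add i1 intervalIntegrable_const,
          intervalIntegral.integral_const, smul_eq_mul]
    _ ≤ _ := by linarith

/-- An integrable function is approximated in `L¹`, uniformly over fine partitions, by the left
Riemann step functions of one continuous function with compact support. -/
lemma exists_continuous_sum_integral_le [CompleteSpace X] {T : ℝ} (hT : 0 < T) {f : ℝ → X}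
    (hf : IntegrableOn f (Ioo 0 T) volume) {θ : ℝ} (hθ : 0 < θ) :
    ∃ g : ℝ → X, HasCompactSupport g ∧ Continuous g ∧ ∃ ε > 0, ∀ (N : ℕ) (τ : ℕ → ℝ),
      τ 0 = 0 → τ N = T → (∀ i < N, τ i < τ (i + 1)) → (∀ i < N, τ (i + 1) - τ i ≤ ε) →
      ∑ i ∈ Finset.range N, ∫ t in (τ i)..(τ (i + 1)), ‖f t - g (τ i)‖ ≤ θ := by
  have hf' : Integrable f (volume.restrict (Ioc 0 T)) := (integrableOn_Ioc_iff_integrableOn_Ioo).2 hf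
  obtain ⟨g, hgc, hfg, hgcont, -⟩ :=
    hf'.exists_hasCompactSupport_integral_sub_le (half_pos hθ)
  obtain ⟨δ, hδ, hgδ⟩ := Metric.uniformContinuous_iff.1
    (hgc.uniformContinuous_of_continuous hgcont) (θ / (2 * T)) (by positivity)
  refine ⟨g, hgc, hgcont, δ / 2, half_pos hδ, fun N τ h0 hN hlt hmesh => ?_⟩
  have hfi := fun i hi => intervalIntegrable_of_partition hf h0 hN hlt (i := i) hi
  have hgi : ∀ a b, IntervalIntegrable g volume a b := fun a b => hgcont.intervalIntegrable a b
  have hd : ∀ i < N, IntervalIntegrable (fun t => ‖f t - g t‖) volume (τ i) (τ (i + 1)) :=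
    fun i hi => ((hfi i hi).sub (hgi _ _)).norm
  calc ∑ i ∈ Finset.range N, ∫ t in (τ i)..(τ (i + 1)), ‖f t - g (τ i)‖
      ≤ ∑ i ∈ Finset.range N, ((∫ t in (τ i)..(τ (i + 1)), ‖f t - g t‖)
          + (τ (i + 1) - τ i) * (θ / (2 * T))) := by
        refine Finset.sum_le_sum fun i hi => ?_
        have hi := Finset.mem_range.1 hi
        rw [← smul_eq_mul, ← intervalIntegral.integral_const,
          ← intervalIntegral.integral_add (hd i hi) intervalIntegrable_const]
        refine intervalIntegral.integral_mono_on (hlt i hi).le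
          ((hfi i hi).sub intervalIntegrable_const).norm
          ((hd i hi).add intervalIntegrable_const) fun t ht => ?_
        refine (norm_sub_le_norm_sub_add_norm_sub _ (g t) _).trans ?_
        gcongr
        rw [← dist_eq_norm]
        refine (hgδ ?_).le
        rw [Real.dist_eq, abs_of_nonneg (sub_nonneg.2 ht.1)]
        linarith [ht.2, hmesh i hi]
    _ = (∫ t in (0)..T, ‖f t - g t‖) + T * (θ / (2 * T)) := by
        rw [Finset.sum_add_distrib, ← Finset.sum_mul, Finset.sum_range_sub, h0, hN, sub_zero,
          intervalIntegral.sum_integral_adjacent_intervals hd, h0, hN]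
    _ ≤ θ / 2 + θ / 2 := by
        rw [intervalIntegral.integral_of_le hT.le]
        gcongr
        field_simp; rfl
    _ = θ := add_halves θ

/-! ### Euler schemes -/

/-- An implicit Euler scheme for `u' + A u ∋ f`, `u(0) = u₀` on `(0, T)`, of mesh and `L¹`-error
less than `ε`. -/
structure IsEulerScheme (A : Set (X × X)) (T : ℝ) (u₀ : X) (f : ℝ → X) (ε : ℝ)
    (N : ℕ) (τ : ℕ → ℝ) (x : ℕ → X) : Prop where
  zero : τ 0 = 0
  last : τ N = T
  initial : x 0 = u₀
  lt : ∀ i < N, τ i < τ (i + 1)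
  mesh : ∀ i < N, τ (i + 1) - τ i < ε
  error : ∑ i ∈ Finset.range N, ∫ t in (τ i)..(τ (i + 1)), ‖f t - mean f (τ i) (τ (i + 1))‖ < ε
  step : ∀ i < N, ∃ v ∈ value A (x (i + 1)),
    (τ (i + 1) - τ i)⁻¹ • (x (i + 1) - x i) + v = mean f (τ i) (τ (i + 1))

lemma exists_mem_Ioc_of_partition {τ : ℕ → ℝ} {N : ℕ} {t : ℝ} (h0 : τ 0 < t) (hN : t ≤ τ N) :
    ∃ i < N, t ∈ Ioc (τ i) (τ (i + 1)) := by
  induction N with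
  | zero => exact absurd hN (not_le.2 h0)
  | succ n ih =>
    by_cases h : t ≤ τ n
    · obtain ⟨i, hi, hit⟩ := ih h
      exact ⟨i, by omega, hit⟩
    · exact ⟨n, by omega, not_le.1 h, hN⟩

lemma IsEulerScheme.exists_near {A : Set (X × X)} {T ε : ℝ} {u₀ : X} {f : ℝ → X} {N : ℕ}
    {τ : ℕ → ℝ} {x : ℕ → X} (h : IsEulerScheme A T u₀ f ε N τ x) (hε : 0 < ε) {t : ℝ}
    (ht : t ∈ Icc 0 T) : ∃ i ≤ N, |τ i - t| < ε := by
  rcases ht.1.eq_or_lt with rfl | h0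
  · exact ⟨0, by omega, by simpa [h.zero] using hε⟩
  · obtain ⟨i, hi, hit⟩ := exists_mem_Ioc_of_partition (h.zero.trans_lt h0) (ht.2.trans h.last.ge)
    refine ⟨i + 1, hi, ?_⟩
    rw [abs_of_nonneg (sub_nonneg.2 hit.2)]
    linarith [hit.1, h.mesh i hi]

lemma exists_isEulerScheme [CompleteSpace X] {A : Set (X × X)} (hA : IsQuasiMAccretive A) {T : ℝ}
    (hT : 0 < T) (u₀ : X) {f : ℝ → X} (hf : IntegrableOn f (Ioo 0 T) volume) {ε : ℝ}
    (hε : 0 < ε) : ∃ N τ x, IsEulerScheme A T u₀ f ε N τ x := by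
  obtain ⟨ω, hω⟩ := hA
  obtain ⟨g, -, -, ε', hε', hg⟩ := exists_continuous_sum_integral_le hT hf
    (show 0 < ε / 4 by positivity)
  -- The uniform mesh must be below `ε`, fine enough for the approximation by `g`, and small enough
  -- that `|ω| * h < 1`, so that each step is solvable.
  set η := min (min ε ε') (|ω| + 1)⁻¹ with hη
  have hη0 : 0 < η := by positivity
  obtain ⟨N, hN⟩ := exists_nat_gt (T / η)
  have hN0 : (0 : ℝ) < N := lt_trans (by positivity) hN
  set h := T / N with hh
  have hh0 : 0 < h := by positivity
  have hhη : h < η := by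
    rw [div_lt_iff₀ hη0] at hN
    rw [hh, div_lt_iff₀ hN0]; linarith
  have hhε : h < ε := hhη.trans_le ((min_le_left _ _).trans (min_le_left _ _))
  have hhε' : h < ε' := hhη.trans_le ((min_le_left _ _).trans (min_le_right _ _))
  have hhω : |ω| * h < 1 := by
    have h1 : h < (|ω| + 1)⁻¹ := hhη.trans_le (min_le_right _ _)
    have h2 := mul_lt_mul_of_pos_left h1 (show 0 < |ω| + 1 by positivity)
    rw [mul_inv_cancel₀ (by positivity)] at h2
    linarith
  choose S hS using fun y m => exists_euler_step hω hh0 hhω y m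
  let τ : ℕ → ℝ := fun i => i * h
  let x : ℕ → X := fun n => Nat.rec u₀ (fun i y => S y (mean f (τ i) (τ (i + 1)))) n
  have hτ : ∀ i, τ (i + 1) - τ i = h := fun i => by simp only [τ]; push_cast; ring
  have hτ0 : τ 0 = 0 := by simp [τ]
  have hτN : τ N = T := by simp only [τ, hh]; field_simp
  have hlt : ∀ i < N, τ i < τ (i + 1) := fun i _ => by linarith [hτ i]
  refine ⟨N, τ, x, hτ0, hτN, rfl, hlt, fun i _ => (hτ i).trans_lt hhε, ?_, fun i _ => ?_⟩
  · refine lt_of_le_of_lt (Finset.sum_le_sum fun i hi => integral_norm_sub_mean_le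
      (hlt i (Finset.mem_range.1 hi)) (intervalIntegrable_of_partition hf hτ0 hτN hlt
        (Finset.mem_range.1 hi)) (g (τ i))) ?_
    rw [← Finset.mul_sum]
    have := hg N τ hτ0 hτN hlt fun i _ => ((hτ i).trans_lt hhε').le
    linarith
  · rw [hτ]
    exact hS (x i) (mean f (τ i) (τ (i + 1)))

/-- Bounds the forcing terms of the majorant by an `L¹` error that does not depend on `i`. -/
lemma stepSum_norm_mean_sub_le [CompleteSpace X] {T : ℝ} {f g : ℝ → X}
    (hf : IntegrableOn f (Ioo 0 T) volume) {N : ℕ} {τ : ℕ → ℝ} (h0 : τ 0 = 0) (hN : τ N = T)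
    (hlt : ∀ i < N, τ i < τ (i + 1)) {i : ℕ} (hi : i ≤ N) :
    stepSum τ (fun l => ‖mean f (τ l) (τ (l + 1)) - g (τ l)‖) i ≤
      ∑ i ∈ Finset.range N, ∫ t in (τ i)..(τ (i + 1)), ‖f t - g (τ i)‖ := by
  calc stepSum τ (fun l => ‖mean f (τ l) (τ (l + 1)) - g (τ l)‖) i
      ≤ stepSum τ (fun l => ‖mean f (τ l) (τ (l + 1)) - g (τ l)‖) N := by
        refine Finset.sum_le_sum_of_subset_of_nonneg (Finset.range_subset_range.2 hi) ?_
        intro l hl _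
        exact mul_nonneg (sub_nonneg.2 (hlt l (Finset.mem_range.1 hl)).le) (norm_nonneg _)
    _ ≤ _ := Finset.sum_le_sum fun l hl => mul_norm_mean_sub_le (hlt l (Finset.mem_range.1 hl))
        (intervalIntegrable_of_partition hf h0 hN hlt (Finset.mem_range.1 hl)) _

/-- The distance of an Euler scheme from its initial value. -/
lemma norm_sub_initial_le {A : Set (X × X)} {ω : ℝ} (hA : IsAccretive (shift A ω))
    {ε c C K : ℝ} (hε : 2 * (2 * |ω| + 1) * ε ≤ 1) (hC : 0 ≤ C) {u₀ z w : X}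
    (hw : w ∈ value A z) (hz : 4 * ‖u₀ - z‖ ≤ c) {g : ℝ → X} (hK : ∀ r, ‖g r - w‖ ≤ K)
    (hKC : ∀ r, 2 * K * r ≤ c / 2 + C * r ^ 2)
    {N : ℕ} {s : ℕ → ℝ} {x m : ℕ → X} (hs0 : s 0 = 0) (hx0 : x 0 = u₀)
    (hs : ∀ i < N, s i < s (i + 1)) (hsε : ∀ i < N, s (i + 1) - s i ≤ ε) (hε0 : 0 ≤ ε)
    (hstep : ∀ i < N, ∃ v ∈ value A (x (i + 1)),
      (s (i + 1) - s i)⁻¹ • (x (i + 1) - x i) + v = m i) :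
    ∀ i ≤ N, ‖x i - u₀‖ ≤ Real.exp (2 * (2 * |ω| + 1) * s i) *
      (c + 2 * stepSum s (fun l => ‖m l - g (s l)‖) i + C * quad ε (s i) 0) := by
  intro i hi
  have hK0 : 0 ≤ K := (norm_nonneg _).trans (hK 0)
  have hb := le_exp_mul_of_recurrence (abs_nonneg ω) hε hK0 (b := fun i => ‖x i - z‖)
    (e := fun l => ‖m l - g (s l)‖) hs0 hs hsε (fun _ => norm_nonneg _) (norm_nonneg _)
    (fun i hi => by
      obtain ⟨v, hv, hvx⟩ := hstep i hi
      have hγ := sub_pos.2 (hs i hi)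
      refine (euler_step_comparison_graph hA hγ hv hw hvx).trans ?_
      gcongr
      exact (norm_sub_le_norm_sub_add_norm_sub _ (g (s i)) _).trans
        (add_le_add le_rfl (hK _))) i hi
  simp only [hx0] at hb
  have hsi := partition_nonneg hs0 hs i hi
  have hP : 1 ≤ Real.exp (2 * (2 * |ω| + 1) * s i) := Real.one_le_exp (by positivity)
  have h1 : ‖x i - u₀‖ ≤ ‖x i - z‖ + ‖u₀ - z‖ := by
    rw [norm_sub_rev u₀ z]; exact norm_sub_le_norm_sub_add_norm_sub _ _ _
  have h2 : ‖u₀ - z‖ ≤ Real.exp (2 * (2 * |ω| + 1) * s i) * ‖u₀ - z‖ :=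
    le_mul_of_one_le_left (norm_nonneg _) hP
  have hq : s i ^ 2 ≤ quad ε (s i) 0 := by
    have : 0 ≤ ε * s i := by positivity
    unfold quad; nlinarith
  have hCq := mul_le_mul_of_nonneg_left hq hC
  calc ‖x i - u₀‖ ≤ Real.exp (2 * (2 * |ω| + 1) * s i) *
      ((‖u₀ - z‖ + 2 * stepSum s (fun l => ‖m l - g (s l)‖) i + 2 * K * s i) + ‖u₀ - z‖) := by
        rw [mul_add]; linarith
    _ ≤ _ := by
        -- The two distances to `z` use at most `c / 2`; `hKC` trades the linear growth in time for
        -- another `c / 2` and a square absorbed by `quad`.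
        refine mul_le_mul_of_nonneg_left ?_ (Real.exp_pos _).le
        linarith [hKC (s i)]

/-- The distance of two Euler schemes with the same initial value. -/
lemma norm_sub_le_majorant {A : Set (X × X)} {ω : ℝ} (hA : IsAccretive (shift A ω))
    {ε c C K : ℝ} (hε : 2 * (2 * |ω| + 1) * ε ≤ 1) (hε0 : 0 ≤ ε) (hc : 0 ≤ c) (hC : 0 ≤ C)
    {u₀ z w : X} (hw : w ∈ value A z) (hz : 4 * ‖u₀ - z‖ ≤ c) {g : ℝ → X}
    (hK : ∀ r, ‖g r - w‖ ≤ K) (hKC : ∀ r, 2 * K * r ≤ c / 2 + C * r ^ 2)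
    (hg : ∀ p q, ‖g p - g q‖ ≤ c + C / 2 * (p - q) ^ 2)
    {N M : ℕ} {s t : ℕ → ℝ} {x y m n : ℕ → X} (hs0 : s 0 = 0) (ht0 : t 0 = 0)
    (hx0 : x 0 = u₀) (hy0 : y 0 = u₀)
    (hs : ∀ i < N, s i < s (i + 1)) (hsε : ∀ i < N, s (i + 1) - s i ≤ ε)
    (ht : ∀ j < M, t j < t (j + 1)) (htε : ∀ j < M, t (j + 1) - t j ≤ ε)
    (hx : ∀ i < N, ∃ v ∈ value A (x (i + 1)),
      (s (i + 1) - s i)⁻¹ • (x (i + 1) - x i) + v = m i)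
    (hy : ∀ j < M, ∃ v ∈ value A (y (j + 1)),
      (t (j + 1) - t j)⁻¹ • (y (j + 1) - y j) + v = n j) :
    ∀ i ≤ N, ∀ j ≤ M, ‖x i - y j‖ ≤ majorant |ω| ε c C s t
      (fun l => ‖m l - g (s l)‖) (fun l => ‖n l - g (t l)‖) i j := by
  refine le_majorant (abs_nonneg ω) hε hc hC hs0 ht0 hs ht hsε htε (fun _ => norm_nonneg _)
    (fun _ => norm_nonneg _) (F := fun i j => ‖m i - n j‖) (a := fun i j => ‖x i - y j‖)
    (fun i hi j hj => ?_) (fun i hi j hj => ?_) (fun i hi => ?_) (fun j hj => ?_)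
  · obtain ⟨v, hv, hvx⟩ := hx i hi
    obtain ⟨v', hv', hvy⟩ := hy j hj
    exact euler_step_comparison hA (sub_pos.2 (hs i hi)) (sub_pos.2 (ht j hj)) hv hv' hvx hvy
  · have h1 : ‖m i - n j‖ ≤ ‖m i - g (s i)‖ + ‖g (s i) - g (t j)‖ + ‖n j - g (t j)‖ := by
      rw [norm_sub_rev (n j)]
      have := norm_add₃_le (a := m i - g (s i)) (b := g (s i) - g (t j)) (c := g (t j) - n j)
      simpa using this
    have h2 := hg (s i) (t j)
    have hsi := partition_nonneg hs0 hs i hi.le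
    have htj := partition_nonneg ht0 ht (j + 1) hj
    -- The forcing is sampled at `t j`, but the recurrence needs `quad` at `t (j + 1)`. The shift
    -- costs a factor 2, hence `C / 2` in `hg`.
    have h3 : (s i - t j) ^ 2 ≤ 2 * quad ε (s i) (t (j + 1)) := by
      have h4 : (t (j + 1) - t j) ^ 2 ≤ ε ^ 2 :=
        pow_le_pow_left₀ (sub_nonneg.2 (ht j hj).le) (htε j hj) 2
      have h5 : 0 ≤ ε * (s i + t (j + 1)) := by positivity
      have h6 := sq_nonneg ((s i - t (j + 1)) - (t (j + 1) - t j))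
      unfold quad
      nlinarith
    have h4 := mul_le_mul_of_nonneg_left h3 (show 0 ≤ C / 2 by positivity)
    linarith
  · have h := norm_sub_initial_le hA hε hC hw hz hK hKC hs0 hx0 hs hsε hε0 hx i hi
    simpa [majorant, hy0, ht0, stepSum] using h
  · have h := norm_sub_initial_le hA hε hC hw hz hK hKC ht0 hy0 ht htε hε0 hy j hj
    have e : quad ε 0 (t j) = quad ε (t j) 0 := by unfold quad; ring
    simpa [majorant, hx0, hs0, stepSum, norm_sub_rev, e] using h

/-- Fine Euler schemes are close to each other at neighbouring times. -/
lemma exists_forall_norm_sub_le [CompleteSpace X] {A : Set (X × X)} (hA : IsQuasiMAccretive A)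
    {T : ℝ} (hT : 0 < T) {u₀ : X} (hu₀ : u₀ ∈ closure (domain A)) {f : ℝ → X}
    (hf : IntegrableOn f (Ioo 0 T) volume) {θ : ℝ} (hθ : 0 < θ) :
    ∃ ε > 0, ∀ ε₁ ≤ ε, ∀ ε₂ ≤ ε, ∀ N s x, IsEulerScheme A T u₀ f ε₁ N s x →
      ∀ M t y, IsEulerScheme A T u₀ f ε₂ M t y →
      ∀ i ≤ N, ∀ j ≤ M, |s i - t j| ≤ 2 * ε → ‖x i - y j‖ ≤ θ := by
  obtain ⟨ω, hω, -⟩ := hA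
  set L := Real.exp (2 * (2 * |ω| + 1) * (T + T)) with hL
  have hL0 : 0 < L := Real.exp_pos _
  -- The bracket of the majorant will be at most `4 * c`: `c` itself, `c / 2` for each step sum, and
  -- `2 * c` for the quadratic term.
  set c := θ / (4 * L) with hcdef
  have hc : 0 < c := by positivity
  obtain ⟨z, ⟨w, hw⟩, hz⟩ := Metric.mem_closure_iff.1 hu₀ (c / 4) (by positivity)
  rw [dist_eq_norm] at hz
  obtain ⟨g, hgc, hgcont, ε', hε', hgsum⟩ := exists_continuous_sum_integral_le hT hf
    (show 0 < c / 4 by positivity)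
  obtain ⟨B, hB⟩ := hgc.exists_bound_of_continuous hgcont
  have hB0 : 0 ≤ B := (norm_nonneg _).trans (hB 0)
  obtain ⟨δ, hδ, hgδ⟩ := Metric.uniformContinuous_iff.1
    (hgc.uniformContinuous_of_continuous hgcont) c hc
  set K := B + ‖w‖ with hKdef
  have hK : ∀ r, ‖g r - w‖ ≤ K := fun r => (norm_sub_le _ _).trans (add_le_add_left (hB r) _)
  have hK0 : 0 ≤ K := by positivity
  -- The first term bounds `‖g p - g q‖` where `|p - q| ≥ δ`, the second gives `hKC` by completing
  -- the square, and the third ensures `C > 0`.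
  set C := 4 * B / δ ^ 2 + 2 * K ^ 2 / c + 1 with hCdef
  have hC : 0 < C := by positivity
  have hKC : ∀ r, 2 * K * r ≤ c / 2 + C * r ^ 2 := fun r => by
    have h1 : 2 * K ^ 2 / c * r ^ 2 ≤ C * r ^ 2 := by
      gcongr
      have : 0 ≤ 4 * B / δ ^ 2 := by positivity
      linarith
    have h2 : 2 * K * r ≤ c / 2 + 2 * K ^ 2 / c * r ^ 2 := by
      rw [← sub_nonneg]
      have : c / 2 + 2 * K ^ 2 / c * r ^ 2 - 2 * K * r = (c - 2 * K * r) ^ 2 / (2 * c) := by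
        field_simp; ring
      rw [this]; positivity
    linarith
  have hg : ∀ p q, ‖g p - g q‖ ≤ c + C / 2 * (p - q) ^ 2 := fun p q => by
    by_cases h : dist p q < δ
    · have := (hgδ h).le
      rw [dist_eq_norm] at this
      have : 0 ≤ C / 2 * (p - q) ^ 2 := by positivity
      linarith
    · push Not at h
      rw [Real.dist_eq] at h
      have h1 : δ ^ 2 ≤ (p - q) ^ 2 := by
        rw [← sq_abs (p - q)]; exact pow_le_pow_left₀ hδ.le h 2
      have h2 : 2 * B ≤ C / 2 * (p - q) ^ 2 := by
        have h3 : 2 * B = (4 * B / δ ^ 2) / 2 * δ ^ 2 := by field_simp; ring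
        rw [h3]
        gcongr
        have : 0 ≤ 2 * K ^ 2 / c := by positivity
        linarith
      have h3 := norm_sub_le (g p) (g q)
      linarith [hB p, hB q]
  -- For times at most `2 * ε` apart, `quad` is at most `4 * ε ^ 2 + 2 * T * ε + 3 * ε ^ 2`, which
  -- is at most `(2 * T + 7) * ε` as `ε ≤ 1`.
  set ε := min (min ε' 1) (min (2 * (2 * |ω| + 1))⁻¹ (2 * c / (C * (2 * T + 7)))) with hεdef
  have hε0 : 0 < ε := by positivity
  have e1 : ε ≤ ε' := (min_le_left _ _).trans (min_le_left _ _)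
  have e2 : ε ≤ 1 := (min_le_left _ _).trans (min_le_right _ _)
  have e3 : 2 * (2 * |ω| + 1) * ε ≤ 1 := by
    have h1 : ε ≤ (2 * (2 * |ω| + 1))⁻¹ := (min_le_right _ _).trans (min_le_left _ _)
    calc _ ≤ 2 * (2 * |ω| + 1) * (2 * (2 * |ω| + 1))⁻¹ := by gcongr
      _ = 1 := mul_inv_cancel₀ (by positivity)
  have e4 : C * ((2 * T + 7) * ε) ≤ 2 * c := by
    have h1 : ε ≤ 2 * c / (C * (2 * T + 7)) := (min_le_right _ _).trans (min_le_right _ _)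
    rw [le_div_iff₀ (by positivity)] at h1
    linarith
  refine ⟨ε, hε0, fun ε₁ hε₁ ε₂ hε₂ N s x hx M t y hy i hi j hj hij => ?_⟩
  have hsε : ∀ i < N, s (i + 1) - s i ≤ ε := fun i hi => (hx.mesh i hi).le.trans hε₁
  have htε : ∀ i < M, t (i + 1) - t i ≤ ε := fun i hi => (hy.mesh i hi).le.trans hε₂
  refine (norm_sub_le_majorant hω e3 hε0.le hc.le hC.le hw (by linarith) hK hKC hg hx.zero hy.zero
    hx.initial hy.initial hx.lt hsε hy.lt htε hx.step hy.step i hi j hj).trans ?_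
  have E1 := (stepSum_norm_mean_sub_le (g := g) hf hx.zero hx.last hx.lt hi).trans
    (hgsum N s hx.zero hx.last hx.lt fun i hi => (hsε i hi).trans e1)
  have E2 := (stepSum_norm_mean_sub_le (g := g) hf hy.zero hy.last hy.lt hj).trans
    (hgsum M t hy.zero hy.last hy.lt fun i hi => (htε i hi).trans e1)
  have hsT : s i ≤ T := hx.last ▸ partition_le hx.lt hi
  have htT : t j ≤ T := hy.last ▸ partition_le hy.lt hj
  have hq : quad ε (s i) (t j) ≤ (2 * T + 7) * ε := by
    have h1 : (s i - t j) ^ 2 ≤ (2 * ε) ^ 2 := by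
      rw [← sq_abs (s i - t j)]; exact pow_le_pow_left₀ (abs_nonneg _) hij 2
    have h2 : ε * (s i + t j) ≤ ε * (T + T) := by gcongr
    have h3 : ε ^ 2 ≤ ε := by nlinarith
    unfold quad
    linarith
  have hCq := mul_le_mul_of_nonneg_left hq hC.le
  have hexp : Real.exp (2 * (2 * |ω| + 1) * (s i + t j)) ≤ L := by
    rw [hL]; gcongr
  unfold majorant
  calc _ ≤ Real.exp (2 * (2 * |ω| + 1) * (s i + t j)) * (4 * c) := by
        gcongr; linarith
    _ ≤ L * (4 * c) := by gcongr
    _ = θ := by rw [hcdef]; field_simp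

/-! ### Mild solutions -/

lemma IsMildSolution.exists_isEulerScheme {A : Set (X × X)} {T : ℝ} {u₀ : X} {f u : ℝ → X}
    (h : IsMildSolution A T u₀ f u) {ε : ℝ} (hε : 0 < ε) :
    ∃ N τ x, IsEulerScheme A T u₀ f ε N τ x ∧
      ∀ i < N, ∀ t ∈ Ioc (τ i) (τ (i + 1)), ‖u t - x (i + 1)‖ < ε := by
  obtain ⟨N, τ, x, h1, h2, h3, h4, h5, h6, h7, h8⟩ := h.approx ε hε
  exact ⟨N, τ, x, ⟨h1, h2, h3, h4, h5, h6, h7⟩, h8⟩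

/-- Each solution is uniformly close to an Euler scheme, and fine schemes with the same data are
close to each other. -/
theorem IsMildSolution.eqOn [CompleteSpace X] {A : Set (X × X)} (hA : IsQuasiMAccretive A)
    {T : ℝ} (hT : 0 < T) {u₀ : X} (hu₀ : u₀ ∈ closure (domain A)) {f : ℝ → X}
    (hf : IntegrableOn f (Ioo 0 T) volume) {u w : ℝ → X} (hu : IsMildSolution A T u₀ f u)
    (hw : IsMildSolution A T u₀ f w) : ∀ t ∈ Icc 0 T, u t = w t := by
  intro t ht
  rcases ht.1.eq_or_lt with rfl | h0
  · rw [hu.initial, hw.initial]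
  refine eq_of_forall_dist_le fun θ hθ => ?_
  obtain ⟨ε, hε, hclose⟩ := exists_forall_norm_sub_le hA hT hu₀ hf (θ := θ / 3) (by positivity)
  have hε' : 0 < min ε (θ / 3) := by positivity
  obtain ⟨N, σ, x, hx, hux⟩ := hu.exists_isEulerScheme hε'
  obtain ⟨M, τ, y, hy, hwy⟩ := hw.exists_isEulerScheme hε'
  obtain ⟨i, hi, hit⟩ := exists_mem_Ioc_of_partition (hx.zero.trans_lt h0) (ht.2.trans hx.last.ge)
  obtain ⟨j, hj, hjt⟩ := exists_mem_Ioc_of_partition (hy.zero.trans_lt h0) (ht.2.trans hy.last.ge)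
  have m1 := (hx.mesh i hi).trans_le (min_le_left _ _)
  have m2 := (hy.mesh j hj).trans_le (min_le_left _ _)
  have hxy := hclose _ (min_le_left _ _) _ (min_le_left _ _) N σ x hx M τ y hy (i + 1) hi (j + 1) hj
    (by rw [abs_le]; constructor <;> linarith [hit.1, hit.2, hjt.1, hjt.2])
  have b1 := (hux i hi t hit).trans_le (min_le_right _ _)
  have b2 := (hwy j hj t hjt).trans_le (min_le_right _ _)
  rw [norm_sub_rev] at b2
  rw [dist_eq_norm]
  have := norm_add₃_le (a := u t - x (i + 1)) (b := x (i + 1) - y (j + 1)) (c := y (j + 1) - w t)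
  rw [sub_add_sub_cancel, sub_add_sub_cancel] at this
  linarith

/-- The solution is the limit of Euler schemes of mesh tending to 0, evaluated at nodes near `t`;
the closeness estimate makes these values Cauchy. -/
theorem exists_isMildSolution [CompleteSpace X] {A : Set (X × X)} (hA : IsQuasiMAccretive A)
    {T : ℝ} (hT : 0 < T) {u₀ : X} (hu₀ : u₀ ∈ closure (domain A)) {f : ℝ → X}
    (hf : IntegrableOn f (Ioo 0 T) volume) : ∃ u, IsMildSolution A T u₀ f u := by
  have hpos : ∀ n : ℕ, (0 : ℝ) < 1 / (n + 1) := fun n => Nat.one_div_pos_of_nat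
  choose N τ x hx using fun n : ℕ => exists_isEulerScheme hA hT u₀ hf (hpos n)
  have hI : ∀ (n : ℕ) (t : ℝ), ∃ i, t ∈ Icc 0 T → i ≤ N n ∧ |τ n i - t| < 1 / ((n : ℝ) + 1) := by
    intro n t
    by_cases ht : t ∈ Icc 0 T
    · obtain ⟨i, hi⟩ := (hx n).exists_near (hpos n) ht
      exact ⟨i, fun _ => hi⟩
    · exact ⟨0, fun h => absurd h ht⟩
  choose I hI using hI
  have hsmall : ∀ ε > 0, ∃ n : ℕ, ∀ m ≥ n, 1 / ((m : ℝ) + 1) ≤ ε := fun ε hε => by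
    obtain ⟨n, hn⟩ := exists_nat_one_div_lt hε
    exact ⟨n, fun m hm => (Nat.one_div_le_one_div hm).trans hn.le⟩
  have hclose := fun θ (hθ : 0 < θ) => exists_forall_norm_sub_le hA hT hu₀ hf hθ
  have hlim : ∀ t, ∃ l, t ∈ Icc 0 T →
      Filter.Tendsto (fun n => x n (I n t)) Filter.atTop (nhds l) := by
    intro t
    by_cases ht : t ∈ Icc 0 T
    · obtain ⟨l, hl⟩ : ∃ l, Filter.Tendsto (fun n => x n (I n t)) Filter.atTop (nhds l) := by
        refine cauchySeq_tendsto_of_complete (Metric.cauchySeq_iff'.2 fun θ hθ => ?_)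
        obtain ⟨ε, hε, h⟩ := hclose (θ / 2) (half_pos hθ)
        obtain ⟨n, hn⟩ := hsmall ε hε
        refine ⟨n, fun m hm => ?_⟩
        rw [dist_eq_norm]
        refine lt_of_le_of_lt (h _ (hn m hm) _ (hn n le_rfl) _ _ _ (hx m) _ _ _ (hx n) _ (hI m t ht).1
          _ (hI n t ht).1 ?_) (half_lt_self hθ)
        have a1 := abs_lt.1 ((hI m t ht).2.trans_le (hn m hm))
        have a2 := abs_lt.1 ((hI n t ht).2.trans_le (hn n le_rfl))
        rw [abs_le]; constructor <;> linarith [a1.1, a1.2, a2.1, a2.2]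
      exact ⟨l, fun _ => hl⟩
    · exact ⟨0, fun h => absurd h ht⟩
  choose u hu using hlim
  -- Letting one scheme tend to its limit gives closeness to `u` uniformly in `t` and in the nearby
  -- node; continuity, the initial value and the approximation property all follow from it.
  have key : ∀ θ > 0, ∃ ε > 0, ∀ n : ℕ, 1 / ((n : ℝ) + 1) ≤ ε → ∀ t ∈ Icc 0 T, ∀ i ≤ N n,
      |τ n i - t| ≤ ε → ‖x n i - u t‖ ≤ θ := by
    intro θ hθ
    obtain ⟨ε, hε, h⟩ := hclose θ hθ
    refine ⟨ε, hε, fun n hn t ht i hi hit => ?_⟩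
    refine le_of_tendsto ((hu t ht).const_sub (x n i)).norm ?_
    obtain ⟨m₀, hm₀⟩ := hsmall ε hε
    filter_upwards [Filter.eventually_ge_atTop m₀] with m hm
    refine h _ hn _ (hm₀ m hm) _ _ _ (hx n) _ _ _ (hx m) _ hi _ (hI m t ht).1 ?_
    have a1 := abs_lt.1 ((hI m t ht).2.trans_le (hm₀ m hm))
    have a2 := abs_le.1 hit
    rw [abs_le]; constructor <;> linarith [a1.1, a1.2, a2.1, a2.2]
  refine ⟨u, ?_, ?_, ?_⟩
  · rw [Metric.continuousOn_iff]
    intro t ht θ hθ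
    obtain ⟨ε, hε, h⟩ := key (θ / 3) (by positivity)
    obtain ⟨n, hn⟩ := hsmall (ε / 2) (half_pos hε)
    have hn := hn n le_rfl
    refine ⟨ε / 2, half_pos hε, fun s hs hst => ?_⟩
    obtain ⟨hi, hit⟩ := hI n t ht
    have b1 := h n (by linarith) t ht _ hi (by linarith)
    have b2 := h n (by linarith) s hs _ hi (by
      rw [Real.dist_eq] at hst
      have a1 := abs_lt.1 hit
      have a2 := abs_lt.1 hst
      rw [abs_le]; constructor <;> linarith [a1.1, a1.2, a2.1, a2.2])
    rw [dist_eq_norm]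
    have b3 := norm_sub_le_norm_sub_add_norm_sub (u s) (x n (I n t)) (u t)
    rw [norm_sub_rev] at b2
    linarith
  · refine eq_of_forall_dist_le fun θ hθ => ?_
    obtain ⟨ε, hε, h⟩ := key θ hθ
    obtain ⟨n, hn⟩ := hsmall ε hε
    have := h n (hn n le_rfl) 0 ⟨le_rfl, hT.le⟩ 0 (Nat.zero_le _) (by simp [(hx n).zero, hε.le])
    rwa [(hx n).initial, ← dist_eq_norm, dist_comm] at this
  · intro θ hθ
    obtain ⟨ε, hε, h⟩ := key (θ / 2) (half_pos hθ)
    obtain ⟨n, hn⟩ := hsmall (min ε θ) (by positivity)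
    have hn := hn n le_rfl
    have hn1 := hn.trans (min_le_left _ _)
    have hn2 := hn.trans (min_le_right _ _)
    have H := hx n
    refine ⟨N n, τ n, x n, H.zero, H.last, H.initial, H.lt, fun i hi => (H.mesh i hi).trans_le hn2,
      H.error.trans_le hn2, H.step, fun i hi t ht => ?_⟩
    have hm := H.mesh i hi
    have h1 := partition_nonneg H.zero H.lt i hi.le
    have h2 : τ n (i + 1) ≤ T := by rw [← H.last]; exact partition_le H.lt hi
    rw [norm_sub_rev]
    refine lt_of_le_of_lt (h n hn1 t ⟨h1.trans ht.1.le, ht.2.trans h2⟩ (i + 1) hi ?_)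
      (half_lt_self hθ)
    rw [abs_of_nonneg (sub_nonneg.2 ht.2)]
    linarith [ht.1]

lemma semigroup_eq_choose {A : Set (X × X)} {T : ℝ} {u₀ : X} {f : ℝ → X}
    (h : ∃ u, IsMildSolution A T u₀ f u) :
    (fun t => semigroup A T t u₀ f) = h.choose := by
  funext t
  simp only [semigroup, dif_pos h]

/-! ### Scaling -/

lemma mean_smul_comp_mul (f : ℝ → X) {r : ℝ} (hr : 0 < r) (κ a b : ℝ) :
    mean (fun s => κ • f (r * s)) (a / r) (b / r) = κ • mean f a b := by
  unfold mean
  rw [intervalIntegral.integral_smul, intervalIntegral.integral_comp_mul_left _ hr.ne',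
    mul_div_cancel₀ _ hr.ne', mul_div_cancel₀ _ hr.ne', smul_comm κ, smul_comm κ, smul_smul,
    ← sub_div, inv_div]
  congr 1
  field_simp

lemma integrableOn_smul_comp_mul {T : ℝ} {f : ℝ → X} (hT : 0 < T)
    (hf : IntegrableOn f (Ioo 0 T) volume) {r : ℝ} (hr : 0 < r) (κ : ℝ) :
    IntegrableOn (fun s => κ • f (r * s)) (Ioo 0 (T / r)) volume := by
  have h1 : IntervalIntegrable f volume 0 T :=
    (intervalIntegrable_iff_integrableOn_Ioo_of_le hT.le).2 hf
  have h2 := (h1.comp_mul_left (c := r)).smul κ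
  rw [zero_div] at h2
  exact (intervalIntegrable_iff_integrableOn_Ioo_of_le (by positivity)).1 h2

lemma smul_mem_closure_domain {A : Set (X × X)} {α : ℝ} (hA : IsHomogeneous A α) {ρ : ℝ}
    (hρ : 0 < ρ) {u₀ : X} (hu₀ : u₀ ∈ closure (domain A)) : ρ • u₀ ∈ closure (domain A) :=
  map_mem_closure (continuous_const_smul ρ) hu₀ fun u hu => (hA.2 u hu ρ hρ).1

/-- Rescaled mild solutions of a homogeneous evolution equation are mild solutions. -/
theorem IsMildSolution.rescale {A : Set (X × X)} {α : ℝ} (hA : IsHomogeneous A α) {T : ℝ}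
    {u₀ : X} {f u : ℝ → X} (hu : IsMildSolution A T u₀ f u) {r ρ : ℝ} (hr : 0 < r) (hρ : 0 < ρ)
    (hrρ : r * ρ = ρ ^ α) :
    IsMildSolution A (T / r) (ρ • u₀) (fun s => ρ ^ α • f (r * s)) (fun t => ρ • u (r * t)) := by
  have hmaps : ∀ {a b t : ℝ}, t ∈ Icc (a / r) (b / r) → r * t ∈ Icc a b := fun {a b t} ht => by
    rw [mem_Icc, div_le_iff₀' hr, le_div_iff₀' hr] at ht; exact ht
  have hmaps' : ∀ {a b t : ℝ}, t ∈ Ioc (a / r) (b / r) → r * t ∈ Ioc a b := fun {a b t} ht => by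
    rw [mem_Ioc, div_lt_iff₀' hr, le_div_iff₀' hr] at ht; exact ht
  refine ⟨?_, by simp [hu.initial], fun ε hε => ?_⟩
  · refine (hu.continuousOn.comp (continuous_const_mul r).continuousOn fun t ht => ?_).const_smul ρ
    exact hmaps (by rwa [zero_div])
  -- Under rescaling the mesh is divided by `r`, distances of values are multiplied by `ρ`, and the
  -- `L¹` error is multiplied by `ρ ^ α / r`.
  obtain ⟨N, τ, x, h⟩ := hu.exists_isEulerScheme (ε := min (ε * r) (min (ε / ρ) (ε * r / ρ ^ α)))
    (by positivity)
  obtain ⟨h, hux⟩ := h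
  refine ⟨N, fun i => τ i / r, fun i => ρ • x i, by simp [h.zero], by simp [h.last],
    by simp [h.initial], fun i hi => ?_, fun i hi => ?_, ?_, fun i hi => ?_, fun i hi t ht => ?_⟩
  · exact div_lt_div_of_pos_right (h.lt i hi) hr
  · rw [← sub_div, div_lt_iff₀ hr]
    exact (h.mesh i hi).trans_le (min_le_left _ _)
  · have e : ∀ i, ∫ t in (τ i / r)..(τ (i + 1) / r),
        ‖ρ ^ α • f (r * t) - mean (fun s => ρ ^ α • f (r * s)) (τ i / r) (τ (i + 1) / r)‖ =
        ρ ^ α / r * ∫ t in (τ i)..(τ (i + 1)), ‖f t - mean f (τ i) (τ (i + 1))‖ := fun i => by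
      rw [mean_smul_comp_mul f hr]
      simp only [← smul_sub, norm_smul, Real.norm_of_nonneg (Real.rpow_nonneg hρ.le α)]
      rw [intervalIntegral.integral_const_mul, intervalIntegral.integral_comp_mul_left
        (fun t => ‖f t - mean f (τ i) (τ (i + 1))‖) hr.ne', mul_div_cancel₀ _ hr.ne',
        mul_div_cancel₀ _ hr.ne', smul_eq_mul, div_eq_mul_inv, mul_assoc]
    simp only [e, ← Finset.mul_sum]
    have h1 := h.error.trans_le ((min_le_right _ _).trans (min_le_right _ _))
    have hρα : 0 < ρ ^ α := Real.rpow_pos_of_pos hρ α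
    rw [lt_div_iff₀ hρα] at h1
    rw [div_mul_eq_mul_div, div_lt_iff₀ hr]
    linarith
  · obtain ⟨v, hv, hvx⟩ := h.step i hi
    refine ⟨ρ ^ α • v, ?_, ?_⟩
    · rw [(hA.2 _ ⟨v, hv⟩ ρ hρ).2]
      exact smul_mem_smul_set hv
    · rw [mean_smul_comp_mul f hr, ← hvx, smul_add, smul_smul, ← hrρ, ← smul_sub, smul_smul,
        ← sub_div, inv_div]
      congr 2
      have := sub_pos.2 (h.lt i hi)
      field_simp
  · rw [← smul_sub, norm_smul, Real.norm_of_nonneg hρ.le]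
    have h1 := (hux i hi (r * t) (hmaps' ht)).trans_le ((min_le_right _ _).trans (min_le_left _ _))
    rw [lt_div_iff₀ hρ] at h1
    linarith

end

end NonlinearEvolution

/-! ### Well-posedness and the scaling identity -/

theorem proposition3 {X : Type*} [NormedAddCommGroup X] [NormedSpace ℝ X] [CompleteSpace X]
    (A : Set (X × X)) (hA : NonlinearEvolution.IsQuasiMAccretive A)
    (α : ℝ) (hα : α ≠ 1) (hhom : NonlinearEvolution.IsHomogeneous A α) :
    -- the semigroup is well defined: it is given by the unique mild solutions
    (∀ T : ℝ, 0 < T → ∀ u₀ ∈ closure (NonlinearEvolution.domain A),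
      ∀ f : ℝ → X, IntegrableOn f (Ioo 0 T) volume →
        NonlinearEvolution.IsMildSolution A T u₀ f
          (fun t => NonlinearEvolution.semigroup A T t u₀ f) ∧
        ∀ u : ℝ → X, NonlinearEvolution.IsMildSolution A T u₀ f u →
          ∀ t ∈ Icc 0 T, u t = NonlinearEvolution.semigroup A T t u₀ f) ∧
    -- the scaling identity
    (∀ T : ℝ, 0 < T → ∀ r : ℝ, 0 < r →
      ∀ u₀ ∈ closure (NonlinearEvolution.domain A),
      ∀ f : ℝ → X, IntegrableOn f (Ioo 0 T) volume →
        ∀ t ∈ Icc 0 (T / r),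
          r ^ (1 / (α - 1)) • NonlinearEvolution.semigroup A T (r * t) u₀ f =
            NonlinearEvolution.semigroup A (T / r) t (r ^ (1 / (α - 1)) • u₀)
              (fun s => r ^ (α / (α - 1)) • f (r * s))) := by
  have hex : ∀ T : ℝ, 0 < T → ∀ u₀ ∈ closure (NonlinearEvolution.domain A),
      ∀ f : ℝ → X, IntegrableOn f (Ioo 0 T) volume → NonlinearEvolution.IsMildSolution A T u₀ f
        (fun t => NonlinearEvolution.semigroup A T t u₀ f) := by
    intro T hT u₀ hu₀ f hf
    have h := NonlinearEvolution.exists_isMildSolution hA hT hu₀ hf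
    rw [NonlinearEvolution.semigroup_eq_choose h]
    exact h.choose_spec
  refine ⟨fun T hT u₀ hu₀ f hf => ⟨hex T hT u₀ hu₀ f hf, fun u hu =>
    hu.eqOn hA hT hu₀ hf (hex T hT u₀ hu₀ f hf)⟩, fun T hT r hr u₀ hu₀ f hf t ht => ?_⟩
  set ρ := r ^ (1 / (α - 1)) with hρdef
  have hρ : 0 < ρ := Real.rpow_pos_of_pos hr _
  have hα' : α - 1 ≠ 0 := sub_ne_zero.2 hα
  have hρα : r ^ (α / (α - 1)) = ρ ^ α := by
    rw [hρdef, ← Real.rpow_mul hr.le, div_mul_eq_mul_div, one_mul]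
  have hrρ : r * ρ = ρ ^ α := by
    rw [← hρα, hρdef]
    nth_rw 1 [← Real.rpow_one r]
    rw [← Real.rpow_add hr]
    congr 1
    field_simp
    ring
  rw [hρα]
  have hu₀' := NonlinearEvolution.smul_mem_closure_domain hhom hρ hu₀
  have hf' := NonlinearEvolution.integrableOn_smul_comp_mul hT hf hr (ρ ^ α)
  -- Both sides are mild solutions of the rescaled problem on `(0, T / r)`, so they agree by
  -- uniqueness.
  exact ((hex T hT u₀ hu₀ f hf).rescale hhom hr hρ hrρ).eqOn hA (by positivity) hu₀' hf'
    (hex (T / r) (by positivity) _ hu₀' _ hf') t ht
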